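/- Let $d\ge 1$ and let $\|\cdot\|$ be a norm on $\mathbb{R}^d$ with dual norm $\|y\|_\star=\sup_{\|x\|\le 1}\langle x,y\rangle$, where $\langle\cdot,\cdot\rangle$ is the standard scalar product. Call a norm $N$ on $\mathbb{R}^d$ orthant-strictly monotonic if $N(x)<N(x')$ whenever $|x_i|\le|x'_i|$ and $x_ix'_i\ge 0$ for all $i$ and $|x_j|<|x'_j|$ for some $j$. For $k\in\{1,\dots,d\}$, let $y\mapsto\sup_{|K|\le k}\|y_K\|_\star$ be the generalized top-$k$ dual norm, where $K$ ranges over the subsets of $\{1,\dots,d\}$ and $y_K$ agrees with $y$ on $K$ and vanishes outside $K$; let the generalized $k$-support dual norm $\|\cdot\|_{(k)}$ be its dual norm, $\|x\|_{(k)}=\sup\{\langle x,y\rangle : \sup_{|K|\le k}\|y_K\|_\star\le 1\}$. Let $\ell_0(x)$ be the number of nonzero components of $x$. Suppose that both $\|\cdot\|$ and $\|\cdot\|_\star$ are orthant-strictly monotonic, let $\varphi:\{0,1,\dots,d\}\to[0,+\infty)$ be nondecreasing with $\varphi(0)=0$, and let $C\subset\mathbb{R}^d$ with $0\notin C$. Then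 $$ \begin{aligned} \min_{x\in C}\varphi(\ell_0(x)) &=\min_{\substack{x\in C,\ x^{(1)},\dots,x^{(d)}\in\mathbb{R}^d\\ \sum_{l=1}^d\|x^{(l)}\|_{(l)}\le 1\\ \sum_{l=1}^d x^{(l)}=x/\|x\|}}\ \sum_{l=1}^d\varphi(l)\,\|x^{(l)}\|_{(l)}\\ &=\min_{\substack{x\in C,\ x^{(1)},\dots,x^{(d)}\in\mathbb{R}^d\\ \sum_{l=1}^d\|x^{(l)}\|_{(l)}\le \|x\|\\ \sum_{l=1}^d x^{(l)}=x}}\ \frac{1}{\|x\|}\sum_{l=1}^d\varphi(l)\,\|x^{(l)}\|_{(l)}\\ &=\min_{x\in C}\ \frac{1}{\|x\|}\ \min_{\substack{x^{(1)},\dots,x^{(d)}\in\mathbb{R}^d\\ \sum_{l=1}^d\|x^{(l)}\|_{(l)}\le \|x\|\\ \sum_{l=1}^d x^{(l)}=x}}\ \sum_{l=1}^d\varphi(l)\,\|x^{(l)}\|_{(l)}, \end{aligned} $$ where all minima are attained (if $C$ is empty, the four minima over $x\in C$ are $+\infty$ by convention), and where, for each $x\in C$, the inner minimization problem in the last line is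 convex: its feasible set is convex and its objective function is convex. -/

import Mathlib

open scoped BigOperators

noncomputable section

namespace SparseReformulation

/-- A norm on `ℝ^d`: a seminorm vanishing only at `0`. It is not tied to any norm that Mathlib
puts on `Fin d → ℝ`. -/
def IsNorm {d : ℕ} (N : Seminorm ℝ (Fin d → ℝ)) : Prop :=
  ∀ x, N x = 0 → x = 0

/-- The number of nonzero components of `x`, as an element of `{0, …, d}`. -/
def l0 {d : ℕ} (x : Fin d → ℝ) : Fin (d + 1) :=
  ⟨(Finset.univ.filter fun i => x i ≠ 0).card,
    Nat.lt_succ_of_le (by simpa using Finset.card_le_univ (Finset.univ.filter fun i => x i ≠ 0))⟩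

/-- The vector `x_K`, which coincides with `x` on `K` and vanishes outside `K`. -/
def coordRestrict {d : ℕ} (K : Finset (Fin d)) (x : Fin d → ℝ) : Fin d → ℝ :=
  fun i => if i ∈ K then x i else 0

/-- The dual norm `y ↦ sup {⟨x, y⟩ : f x ≤ 1}` of `f`, where `f` is (the function of) a norm. -/
def dualNorm {d : ℕ} (f : (Fin d → ℝ) → ℝ) (y : Fin d → ℝ) : ℝ :=
  sSup {r | ∃ x : Fin d → ℝ, f x ≤ 1 ∧ r = x ⬝ᵥ y}

/-- The generalized top-`k` dual norm `y ↦ sup {‖y_K‖_⋆ : #K ≤ k}`. -/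
def topDualNorm {d : ℕ} (f : (Fin d → ℝ) → ℝ) (k : ℕ) (y : Fin d → ℝ) : ℝ :=
  ⨆ K : {K : Finset (Fin d) // K.card ≤ k}, dualNorm f (coordRestrict K.1 y)

/-- The generalized `k`-support dual norm (for `1 ≤ k ≤ d`): the dual norm of the generalized
top-`k` dual norm. -/
def supportDualNorm {d : ℕ} (f : (Fin d → ℝ) → ℝ) (k : ℕ) : (Fin d → ℝ) → ℝ :=
  dualNorm (topDualNorm f k)

/-- `f` is orthant-strictly monotonic: `|x| < |x'|` (componentwise `≤`, with one strict
inequality) and `x ∘ x' ≥ 0` imply `f x < f x'`. -/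
def OrthantStrictlyMonotonic {d : ℕ} (f : (Fin d → ℝ) → ℝ) : Prop :=
  ∀ x x' : Fin d → ℝ, (∀ i, |x i| ≤ |x' i|) → (∃ j, |x j| < |x' j|) →
    (∀ i, 0 ≤ x i * x' i) → f x < f x'

/-- `∑_{l=1}^d ‖z^(l)‖`, with the `l`-support dual norm on the `l`-th vector. The vector `z^(l)`
is `z j` with `l = j + 1`, `j : Fin d`. -/
def totalNorm {d : ℕ} (f : (Fin d → ℝ) → ℝ) (z : Fin d → Fin d → ℝ) : ℝ :=
  ∑ j : Fin d, supportDualNorm f ((j : ℕ) + 1) (z j)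

/-- `∑_{l=1}^d φ(l) ‖z^(l)‖`, with the `l`-support dual norm on the `l`-th vector. -/
def objective {d : ℕ} (f : (Fin d → ℝ) → ℝ) (φ : Fin (d + 1) → ℝ) (z : Fin d → Fin d → ℝ) : ℝ :=
  ∑ j : Fin d, φ j.succ * supportDualNorm f ((j : ℕ) + 1) (z j)

/-- The decompositions `u = ∑_l z^(l)` with `∑_l ‖z^(l)‖ ≤ ρ`. -/
def decompositions {d : ℕ} (f : (Fin d → ℝ) → ℝ) (ρ : ℝ) (u : Fin d → ℝ) :
    Set (Fin d → Fin d → ℝ) :=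
  {z | totalNorm f z ≤ ρ ∧ ∑ j : Fin d, z j = u}

/-- `m` is the minimum of the set `S` of values of a minimization problem: either the problem has
no feasible point and `m = +∞`, or `m` is a real number and is attained. -/
def IsMinValue (S : Set ℝ) (m : EReal) : Prop :=
  (S = ∅ ∧ m = ⊤) ∨ ∃ r : ℝ, IsLeast S r ∧ m = (r : EReal)

end SparseReformulation

end

/-!
Let `y` be a dual vector of `x`: its dual norm is at most `1` and `⟨x, y⟩ = ‖x‖`. If
`x = ∑ z⁽ˡ⁾` with `∑ ‖z⁽ˡ⁾‖₍ₗ₎ ≤ ‖x‖`, then Hölder's inequality for each pair of dual norms gives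
`‖x‖ = ∑ ⟨z⁽ˡ⁾, y⟩ ≤ ∑ τₗ ‖z⁽ˡ⁾‖₍ₗ₎ ≤ ∑ ‖z⁽ˡ⁾‖₍ₗ₎ ≤ ‖x‖`, where `τₗ ≤ 1` is the top-`l` dual norm
of `y`. Hence every inequality is an equality, and `z⁽ˡ⁾ = 0` as soon as `τₗ < 1`. Strict
monotonicity of the norm forces `y` to be nonzero on the support of `x`, and that of the dual norm
then gives `τₗ < 1` for all `l < ℓ₀(x)`. So only the levels `l ≥ ℓ₀(x)` carry mass, which costs at
least `φ(ℓ₀(x)) ‖x‖`; the decomposition with the single term `x` at level `ℓ₀(x)` attains this.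
-/

namespace SparseReformulation

variable {d : ℕ} {f : (Fin d → ℝ) → ℝ} {x y : Fin d → ℝ} {k : ℕ}

/-- An absolutely homogeneous function on `ℝ^d` bounded below by a positive multiple of the sup
norm. Subadditivity is not required: `dualNorm f` is a norm without it. -/
structure IsCoerciveGauge (f : (Fin d → ℝ) → ℝ) : Prop where
  map_smul : ∀ (t : ℝ) (x : Fin d → ℝ), f (t • x) = |t| * f x
  coercive : ∃ c > 0, ∀ x : Fin d → ℝ, c * ‖x‖ ≤ f x

namespace IsCoerciveGauge

lemma map_zero (hf : IsCoerciveGauge f) : f 0 = 0 := by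
  simpa using hf.map_smul 0 0

lemma nonneg (hf : IsCoerciveGauge f) (x : Fin d → ℝ) : 0 ≤ f x := by
  obtain ⟨c, hc, hcf⟩ := hf.coercive
  exact (mul_nonneg hc.le (norm_nonneg x)).trans (hcf x)

lemma eq_zero_of_map_eq_zero (hf : IsCoerciveGauge f) (hx : f x = 0) : x = 0 := by
  obtain ⟨c, hc, hcf⟩ := hf.coercive
  have hnorm : c * ‖x‖ ≤ 0 := hx ▸ hcf x
  exact norm_le_zero_iff.mp (nonpos_of_mul_nonpos_right hnorm hc)

lemma bddAbove_dotProduct (hf : IsCoerciveGauge f) (y : Fin d → ℝ) :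
    BddAbove {r | ∃ x : Fin d → ℝ, f x ≤ 1 ∧ r = x ⬝ᵥ y} := by
  obtain ⟨c, hc, hcf⟩ := hf.coercive
  refine ⟨∑ i, c⁻¹ * |y i|, ?_⟩
  rintro _ ⟨x, hx, rfl⟩
  have hnorm : ‖x‖ ≤ c⁻¹ := by
    rw [← one_div, le_div_iff₀' hc]
    exact (hcf x).trans hx
  refine Finset.sum_le_sum fun i _ => ?_
  calc x i * y i ≤ |x i| * |y i| := (le_abs_self _).trans_eq (abs_mul _ _)
    _ ≤ c⁻¹ * |y i| := by gcongr; exact (norm_le_pi_norm x i).trans hnorm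

lemma dotProduct_le_dualNorm (hf : IsCoerciveGauge f) (hx : f x ≤ 1) (y : Fin d → ℝ) :
    x ⬝ᵥ y ≤ dualNorm f y :=
  le_csSup (hf.bddAbove_dotProduct y) ⟨x, hx, rfl⟩

lemma dualNorm_le (hf : IsCoerciveGauge f) {r : ℝ} (h : ∀ x, f x ≤ 1 → x ⬝ᵥ y ≤ r) :
    dualNorm f y ≤ r := by
  refine csSup_le ⟨0, 0, by simp [hf.map_zero], by simp⟩ ?_
  rintro _ ⟨x, hx, rfl⟩
  exact h x hx

lemma dualNorm_nonneg (hf : IsCoerciveGauge f) (y : Fin d → ℝ) : 0 ≤ dualNorm f y := by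
  simpa using hf.dotProduct_le_dualNorm (x := 0) (by simp [hf.map_zero]) y

lemma dotProduct_le_mul_dualNorm (hf : IsCoerciveGauge f) (x y : Fin d → ℝ) :
    x ⬝ᵥ y ≤ f x * dualNorm f y := by
  rcases (hf.nonneg x).eq_or_lt' with hx | hx
  · simp [hf.eq_zero_of_map_eq_zero hx, hf.map_zero]
  · have hunit : f ((f x)⁻¹ • x) ≤ 1 := by
      rw [hf.map_smul, abs_of_pos (inv_pos.mpr hx), inv_mul_cancel₀ hx.ne']
    have h := hf.dotProduct_le_dualNorm hunit y
    rwa [smul_dotProduct, smul_eq_mul, inv_mul_le_iff₀ hx] at h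

/-- The dual norm of a coercive gauge, bundled as a seminorm so that homogeneity and convexity are
inherited from `Seminorm`. -/
noncomputable def dualSeminorm (hf : IsCoerciveGauge f) : Seminorm ℝ (Fin d → ℝ) :=
  Seminorm.ofSMulLE (dualNorm f)
    (le_antisymm (hf.dualNorm_le fun x _ => (dotProduct_zero x).le) (hf.dualNorm_nonneg 0))
    (fun y z => hf.dualNorm_le fun x hx => by
      rw [dotProduct_add]
      exact add_le_add (hf.dotProduct_le_dualNorm hx y) (hf.dotProduct_le_dualNorm hx z))
    (fun t y => hf.dualNorm_le fun x hx => by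
      calc x ⬝ᵥ t • y = (t • x) ⬝ᵥ y := by rw [dotProduct_smul, smul_dotProduct]
        _ ≤ |t| * f x * dualNorm f y := hf.map_smul t x ▸ hf.dotProduct_le_mul_dualNorm _ _
        _ ≤ ‖t‖ * dualNorm f y := by
          gcongr
          · exact hf.dualNorm_nonneg y
          · exact mul_le_of_le_one_right (abs_nonneg t) hx)

lemma dualNorm_zero (hf : IsCoerciveGauge f) : dualNorm f 0 = 0 :=
  _root_.map_zero hf.dualSeminorm

lemma convexOn_dualNorm (hf : IsCoerciveGauge f) : ConvexOn ℝ Set.univ (dualNorm f) :=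
  hf.dualSeminorm.convexOn

lemma abs_apply_le (hf : IsCoerciveGauge f) (y : Fin d → ℝ) (i : Fin d) :
    |y i| ≤ f (Pi.single i 1) * dualNorm f y := by
  have h := hf.dotProduct_le_mul_dualNorm (Pi.single i 1)
  refine abs_le'.mpr ⟨by simpa using h y, ?_⟩
  calc -y i ≤ f (Pi.single i 1) * dualNorm f (-y) := by simpa using h (-y)
    _ = f (Pi.single i 1) * dualNorm f y := congrArg _ (map_neg_eq_map hf.dualSeminorm y)

lemma dual (hf : IsCoerciveGauge f) : IsCoerciveGauge (dualNorm f) := by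
  refine ⟨map_smul_eq_mul hf.dualSeminorm, ?_⟩
  have hsingle : ∀ i, 0 ≤ f (Pi.single i (1 : ℝ)) := fun i => hf.nonneg _
  set S : ℝ := 1 + ∑ i, f (Pi.single i (1 : ℝ))
  have hS : 0 < S := add_pos_of_pos_of_nonneg one_pos (Finset.sum_nonneg fun i _ => hsingle i)
  refine ⟨S⁻¹, inv_pos.mpr hS, fun y => (inv_mul_le_iff₀ hS).mpr ?_⟩
  refine (pi_norm_le_iff_of_nonneg (mul_nonneg hS.le (hf.dualNorm_nonneg y))).mpr fun i => ?_
  refine (hf.abs_apply_le y i).trans (mul_le_mul_of_nonneg_right ?_ (hf.dualNorm_nonneg y))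
  exact (Finset.single_le_sum (fun i _ => hsingle i) (Finset.mem_univ i)).trans
    (le_add_of_nonneg_left zero_le_one)

end IsCoerciveGauge

lemma IsNorm.pos {N : Seminorm ℝ (Fin d → ℝ)} (hN : IsNorm N) (hx : x ≠ 0) : 0 < N x :=
  (apply_nonneg N x).lt_of_ne' (mt (hN x) hx)

lemma IsNorm.isCoerciveGauge {N : Seminorm ℝ (Fin d → ℝ)} (hN : IsNorm N) :
    IsCoerciveGauge N := by
  refine ⟨map_smul_eq_mul N, ?_⟩
  rcases subsingleton_or_nontrivial (Fin d → ℝ) with _ | _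
  · exact ⟨1, one_pos, fun x => by simp [Subsingleton.elim x 0]⟩
  have hcont : Continuous N := continuousOn_univ.mp (N.convexOn.continuousOn isOpen_univ)
  obtain ⟨u, hu, hmin⟩ := (isCompact_sphere (0 : Fin d → ℝ) 1).exists_isMinOn
    (NormedSpace.sphere_nonempty.mpr zero_le_one) hcont.continuousOn
  refine ⟨N u, hN.pos (ne_zero_of_mem_unit_sphere ⟨u, hu⟩), fun x => ?_⟩
  rcases eq_or_ne x 0 with rfl | hx
  · simp
  have hunit : ‖x‖⁻¹ • x ∈ Metric.sphere (0 : Fin d → ℝ) 1 := by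
    simp [norm_smul, hx]
  have h : N u ≤ N (‖x‖⁻¹ • x) := hmin hunit
  rwa [map_smul_eq_mul, norm_inv, norm_norm, le_inv_mul_iff₀' (norm_pos_iff.mpr hx)] at h

/-- The vector `y` is dual to `x` for `f`: it lies in the unit ball of the dual norm and attains
equality in `⟨x, y⟩ ≤ f x`. Such a `y` certifies lower bounds for decompositions of `x`. -/
def IsDualVector (f : (Fin d → ℝ) → ℝ) (x y : Fin d → ℝ) : Prop :=
  dualNorm f y ≤ 1 ∧ x ⬝ᵥ y = f x

lemma exists_dual_le_seminorm_apply_eq {E : Type*} [AddCommGroup E] [Module ℝ E]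
    (p : Seminorm ℝ E) (x : E) : ∃ g : Module.Dual ℝ E, (∀ v, g v ≤ p v) ∧ g x = p x := by
  have hwell : ∀ c : ℝ, c • x = 0 → c • p x = 0 := fun c hc => by
    have h := map_smul_eq_mul p c x
    rw [hc, map_zero, eq_comm, mul_eq_zero, norm_eq_zero] at h
    rwa [smul_eq_mul, mul_eq_zero]
  let g₀ : E →ₗ.[ℝ] ℝ := LinearPMap.mkSpanSingleton' x (p x) hwell
  have hg₀ : ∀ v, g₀.toFun v ≤ p v := by
    rintro ⟨v, hv⟩
    obtain ⟨t, rfl⟩ := Submodule.mem_span_singleton.mp hv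
    calc g₀ ⟨t • x, hv⟩ = t * p x := LinearPMap.mkSpanSingleton'_apply x (p x) hwell t hv
      _ ≤ |t| * p x := mul_le_mul_of_nonneg_right (le_abs_self t) (apply_nonneg p x)
      _ = p (t • x) := (map_smul_eq_mul p t x).symm
  obtain ⟨g, hg, hgp⟩ :=
    Module.Dual.exists_extension_of_le_seminorm_real g₀.domain g₀.toFun hg₀
  have hx : x ∈ Submodule.span ℝ {x} := Submodule.mem_span_singleton_self x
  exact ⟨g, fun v => (le_abs_self _).trans (hgp v), (hg ⟨x, hx⟩).trans
    (LinearPMap.mkSpanSingleton'_apply_self x (p x) hwell hx)⟩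

lemma IsNorm.exists_isDualVector {N : Seminorm ℝ (Fin d → ℝ)} (hN : IsNorm N)
    (x : Fin d → ℝ) : ∃ y, IsDualVector N x y := by
  obtain ⟨g, hg, hgx⟩ := exists_dual_le_seminorm_apply_eq N x
  have hdot : ∀ v, v ⬝ᵥ (dotProductEquiv ℝ (Fin d)).symm g = g v := fun v => by
    rw [dotProduct_comm, ← dotProductEquiv_apply_apply, LinearEquiv.apply_symm_apply]
  refine ⟨(dotProductEquiv ℝ (Fin d)).symm g, ?_, (hdot x).trans hgx⟩
  exact hN.isCoerciveGauge.dualNorm_le fun v hv => (hdot v).trans_le ((hg v).trans hv)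

/-- The support of `x`; its cardinality is `l0 x`. -/
noncomputable def supp (x : Fin d → ℝ) : Finset (Fin d) :=
  Finset.univ.filter fun i => x i ≠ 0

lemma mem_supp {i : Fin d} : i ∈ supp x ↔ x i ≠ 0 := by
  simp [supp]

lemma card_supp (x : Fin d → ℝ) : (supp x).card = l0 x :=
  rfl

lemma l0_ne_zero (hx : x ≠ 0) : l0 x ≠ 0 := by
  obtain ⟨i, hi⟩ := Function.ne_iff.mp hx
  refine Fin.val_ne_zero_iff.mp ?_
  rw [← card_supp]
  exact Finset.card_ne_zero_of_mem (mem_supp.mpr hi)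

lemma l0_smul {t : ℝ} (ht : t ≠ 0) (x : Fin d → ℝ) : l0 (t • x) = l0 x := by
  simp [l0, ht]

lemma coordRestrict_smul (K : Finset (Fin d)) (t : ℝ) (x : Fin d → ℝ) :
    coordRestrict K (t • x) = t • coordRestrict K x := by
  ext i
  simp [coordRestrict]

lemma dotProduct_coordRestrict (K : Finset (Fin d)) (x y : Fin d → ℝ) :
    x ⬝ᵥ coordRestrict K y = coordRestrict K x ⬝ᵥ y := by
  simp [dotProduct, coordRestrict]

lemma coordRestrict_eq_self {K : Finset (Fin d)} (h : supp x ⊆ K) : coordRestrict K x = x := by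
  ext i
  have hi : i ∉ K → x i = 0 := fun hiK => not_not.mp (mt (mem_supp.mpr ·) (mt (@h i) hiK))
  by_cases hiK : i ∈ K <;> simp [coordRestrict, hiK, hi]

lemma dualNorm_coordRestrict_le_topDualNorm (f : (Fin d → ℝ) → ℝ) {K : Finset (Fin d)}
    (hK : K.card ≤ k) (y : Fin d → ℝ) : dualNorm f (coordRestrict K y) ≤ topDualNorm f k y :=
  le_ciSup (f := fun K : {K : Finset (Fin d) // K.card ≤ k} => dualNorm f (coordRestrict K.1 y))
    (Set.finite_range _).bddAbove ⟨K, hK⟩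

lemma exists_topDualNorm_eq (f : (Fin d → ℝ) → ℝ) (k : ℕ) (y : Fin d → ℝ) :
    ∃ K : Finset (Fin d), K.card ≤ k ∧ topDualNorm f k y = dualNorm f (coordRestrict K y) := by
  have : Nonempty {K : Finset (Fin d) // K.card ≤ k} := ⟨∅, by simp⟩
  obtain ⟨⟨K, hK⟩, hKy⟩ := exists_eq_ciSup_of_finite
    (f := fun K : {K : Finset (Fin d) // K.card ≤ k} => dualNorm f (coordRestrict K.1 y))
  exact ⟨K, hK, hKy.symm⟩

lemma IsCoerciveGauge.topDual (hf : IsCoerciveGauge f) (hk : 0 < k) :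
    IsCoerciveGauge (topDualNorm f k) := by
  refine ⟨fun t y => ?_, ?_⟩
  · simp only [topDualNorm, coordRestrict_smul, hf.dual.map_smul]
    exact (Real.mul_iSup_of_nonneg (abs_nonneg t) _).symm
  · obtain ⟨c, hc, hcf⟩ := hf.dual.coercive
    refine ⟨c, hc, fun y => ?_⟩
    have hrestrict : ∀ K : Finset (Fin d), K.card ≤ k →
        c * ‖coordRestrict K y‖ ≤ topDualNorm f k y := fun K hK =>
      (hcf _).trans (dualNorm_coordRestrict_le_topDualNorm f hK y)
    have hnonneg : 0 ≤ topDualNorm f k y :=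
      (mul_nonneg hc.le (norm_nonneg _)).trans (hrestrict ∅ (by simp))
    rw [← le_div_iff₀' hc, pi_norm_le_iff_of_nonneg (div_nonneg hnonneg hc.le)]
    intro i
    calc ‖y i‖ = ‖coordRestrict {i} y i‖ := by simp [coordRestrict]
      _ ≤ ‖coordRestrict {i} y‖ := norm_le_pi_norm _ i
      _ ≤ topDualNorm f k y / c :=
        (le_div_iff₀' hc).mpr (hrestrict {i} ((Finset.card_singleton i).trans_le hk))

lemma IsCoerciveGauge.supportDualNorm_le_of_l0_le (hf : IsCoerciveGauge f) (hk : 0 < k)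
    (hx : (l0 x : ℕ) ≤ k) : supportDualNorm f k x ≤ f x := by
  refine (hf.topDual hk).dualNorm_le fun y hy => ?_
  have hyK : dualNorm f (coordRestrict (supp x) y) ≤ 1 :=
    (dualNorm_coordRestrict_le_topDualNorm f hx y).trans hy
  calc y ⬝ᵥ x = x ⬝ᵥ coordRestrict (supp x) y := by
        rw [dotProduct_coordRestrict, coordRestrict_eq_self subset_rfl, dotProduct_comm]
    _ ≤ f x * dualNorm f (coordRestrict (supp x) y) := hf.dotProduct_le_mul_dualNorm _ _
    _ ≤ f x := mul_le_of_le_one_right (hf.nonneg x) hyK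

namespace OrthantStrictlyMonotonic

lemma coordRestrict_lt (hf : OrthantStrictlyMonotonic f) {K : Finset (Fin d)}
    (hK : ¬supp x ⊆ K) : f (coordRestrict K x) < f x := by
  obtain ⟨j, hjx, hjK⟩ := Finset.not_subset.mp hK
  refine hf _ _ (fun i => ?_) ⟨j, ?_⟩ fun i => ?_
  · by_cases hi : i ∈ K <;> simp [coordRestrict, hi]
  · simp [coordRestrict, hjK, mem_supp.mp hjx]
  · by_cases hi : i ∈ K <;> simp [coordRestrict, hi, mul_self_nonneg]

lemma coordRestrict_le (hf : OrthantStrictlyMonotonic f) (K : Finset (Fin d))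
    (x : Fin d → ℝ) : f (coordRestrict K x) ≤ f x := by
  by_cases hK : supp x ⊆ K
  · rw [coordRestrict_eq_self hK]
  · exact (hf.coordRestrict_lt hK).le

lemma topDualNorm_le (hf : OrthantStrictlyMonotonic (dualNorm f)) (k : ℕ) (y : Fin d → ℝ) :
    topDualNorm f k y ≤ dualNorm f y := by
  obtain ⟨K, -, hKy⟩ := exists_topDualNorm_eq f k y
  exact hKy.trans_le (hf.coordRestrict_le K y)

lemma topDualNorm_lt (hf : OrthantStrictlyMonotonic (dualNorm f)) (hk : k < (supp y).card) :
    topDualNorm f k y < dualNorm f y := by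
  obtain ⟨K, hK, hKy⟩ := exists_topDualNorm_eq f k y
  refine hKy.trans_lt (hf.coordRestrict_lt fun hsub => ?_)
  exact (Finset.card_le_card hsub).not_gt (hK.trans_lt hk)

end OrthantStrictlyMonotonic

lemma IsDualVector.supp_subset (hxy : IsDualVector f x y) (hf : IsCoerciveGauge f)
    (hmono : OrthantStrictlyMonotonic f) : supp x ⊆ supp y := by
  by_contra hsub
  have hle : f x ≤ f (coordRestrict (supp y) x) :=
    calc f x = coordRestrict (supp y) x ⬝ᵥ y := by
          rw [← dotProduct_coordRestrict, coordRestrict_eq_self subset_rfl, hxy.2]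
      _ ≤ f (coordRestrict (supp y) x) * dualNorm f y := hf.dotProduct_le_mul_dualNorm _ _
      _ ≤ f (coordRestrict (supp y) x) := mul_le_of_le_one_right (hf.nonneg _) hxy.1
  exact hle.not_gt (hmono.coordRestrict_lt hsub)

lemma IsDualVector.topDualNorm_lt_one (hxy : IsDualVector f x y) (hf : IsCoerciveGauge f)
    (hmono : OrthantStrictlyMonotonic f) (hmonoDual : OrthantStrictlyMonotonic (dualNorm f))
    (hk : k < (l0 x : ℕ)) : topDualNorm f k y < 1 :=
  (hmonoDual.topDualNorm_lt
    (hk.trans_le (Finset.card_le_card (hxy.supp_subset hf hmono)))).trans_le hxy.1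

section Decompositions

variable {φ : Fin (d + 1) → ℝ} {z : Fin d → Fin d → ℝ}

lemma IsCoerciveGauge.supportDualNorm_nonneg (hf : IsCoerciveGauge f) (hk : 0 < k)
    (x : Fin d → ℝ) : 0 ≤ supportDualNorm f k x :=
  (hf.topDual hk).dualNorm_nonneg x

lemma totalNorm_eq_objective_one (f : (Fin d → ℝ) → ℝ) : totalNorm f = objective f 1 := by
  ext z
  simp [totalNorm, objective]

lemma IsCoerciveGauge.convexOn_objective (hf : IsCoerciveGauge f) (hφ : ∀ k, 0 ≤ φ k) :
    ConvexOn ℝ Set.univ (objective f φ) := by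
  have hsum : objective f φ =
      ∑ j : Fin d, fun z => φ j.succ • supportDualNorm f (j + 1) (z j) := by
    ext z
    simp [objective]
  rw [hsum]
  refine Finset.sum_induction _ (ConvexOn ℝ Set.univ) (fun _ _ => ConvexOn.add)
    (convexOn_const 0 convex_univ) fun j _ => ?_
  exact ((hf.topDual j.1.succ_pos).convexOn_dualNorm.comp_linearMap
    (LinearMap.proj j : (Fin d → Fin d → ℝ) →ₗ[ℝ] Fin d → ℝ)).smul (hφ j.succ)

lemma IsCoerciveGauge.convex_decompositions (hf : IsCoerciveGauge f) (ρ : ℝ) (u : Fin d → ℝ) :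
    Convex ℝ (decompositions f ρ u) := by
  have hnorm : ConvexOn ℝ Set.univ (totalNorm f) :=
    totalNorm_eq_objective_one f ▸ hf.convexOn_objective fun _ => zero_le_one
  have hsum : IsLinearMap ℝ fun z : Fin d → Fin d → ℝ => ∑ j, z j :=
    ⟨fun z w => Finset.sum_add_distrib, fun t z => by simp [Finset.smul_sum]⟩
  have hball : Convex ℝ {z | totalNorm f z ≤ ρ} := by simpa using hnorm.convex_le ρ
  exact hball.inter ((convex_singleton u).is_linear_preimage hsum)

lemma IsCoerciveGauge.objective_single (hf : IsCoerciveGauge f) (φ : Fin (d + 1) → ℝ) (j : Fin d)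
    (x : Fin d → ℝ) :
    objective f φ (Pi.single j x) = φ j.succ * supportDualNorm f (j + 1) x := by
  rw [objective, Finset.sum_eq_single_of_mem j (Finset.mem_univ j), Pi.single_eq_same]
  intro i _ hij
  rw [Pi.single_eq_of_ne hij, supportDualNorm, (hf.topDual i.1.succ_pos).dualNorm_zero, mul_zero]

lemma IsCoerciveGauge.single_mem_decompositions (hf : IsCoerciveGauge f) {j : Fin d}
    (hj : j.succ = l0 x) : Pi.single j x ∈ decompositions f (f x) x := by
  refine ⟨?_, by simp⟩
  rw [totalNorm_eq_objective_one, hf.objective_single, Pi.one_apply, one_mul]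
  exact hf.supportDualNorm_le_of_l0_le j.1.succ_pos (hj ▸ le_rfl)

lemma IsCoerciveGauge.sum_dotProduct_le (hf : IsCoerciveGauge f) (z : Fin d → Fin d → ℝ)
    (y : Fin d → ℝ) : (∑ j, z j) ⬝ᵥ y ≤
      ∑ j : Fin d, topDualNorm f (j + 1) y * supportDualNorm f (j + 1) (z j) := by
  rw [dotProduct_comm, dotProduct_sum]
  exact Finset.sum_le_sum fun j _ => (hf.topDual j.1.succ_pos).dotProduct_le_mul_dualNorm y (z j)

lemma OrthantStrictlyMonotonic.topDualNorm_mul_supportDualNorm_le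
    (hmonoDual : OrthantStrictlyMonotonic (dualNorm f)) (hf : IsCoerciveGauge f) (hk : 0 < k)
    (hy : dualNorm f y ≤ 1) (v : Fin d → ℝ) :
    topDualNorm f k y * supportDualNorm f k v ≤ supportDualNorm f k v :=
  mul_le_of_le_one_left (hf.supportDualNorm_nonneg hk v) ((hmonoDual.topDualNorm_le k y).trans hy)

namespace IsDualVector

lemma le_sum_topDualNorm_mul (hxy : IsDualVector f x y) (hf : IsCoerciveGauge f)
    (hz : ∑ j, z j = x) :
    f x ≤ ∑ j : Fin d, topDualNorm f (j + 1) y * supportDualNorm f (j + 1) (z j) := by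
  rw [← hxy.2, ← hz]
  exact hf.sum_dotProduct_le z y

lemma totalNorm_eq (hxy : IsDualVector f x y) (hf : IsCoerciveGauge f)
    (hmonoDual : OrthantStrictlyMonotonic (dualNorm f)) (hz : z ∈ decompositions f (f x) x) :
    totalNorm f z = f x :=
  le_antisymm hz.1 <| (hxy.le_sum_topDualNorm_mul hf hz.2).trans <|
    Finset.sum_le_sum fun j _ =>
      hmonoDual.topDualNorm_mul_supportDualNorm_le hf j.1.succ_pos hxy.1 (z j)

lemma topDualNorm_mul_eq (hxy : IsDualVector f x y) (hf : IsCoerciveGauge f)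
    (hmonoDual : OrthantStrictlyMonotonic (dualNorm f)) (hz : z ∈ decompositions f (f x) x)
    (j : Fin d) :
    topDualNorm f (j + 1) y * supportDualNorm f (j + 1) (z j) =
      supportDualNorm f (j + 1) (z j) := by
  have hle : ∀ i ∈ Finset.univ, topDualNorm f (i.1 + 1) y * supportDualNorm f (i.1 + 1) (z i) ≤
      supportDualNorm f (i.1 + 1) (z i) := fun i _ =>
    hmonoDual.topDualNorm_mul_supportDualNorm_le hf i.1.succ_pos hxy.1 (z i)
  exact (Finset.sum_eq_sum_iff_of_le hle).mp (le_antisymm (Finset.sum_le_sum hle)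
    (hz.1.trans (hxy.le_sum_topDualNorm_mul hf hz.2))) j (Finset.mem_univ j)

lemma supportDualNorm_eq_zero (hxy : IsDualVector f x y) (hf : IsCoerciveGauge f)
    (hmono : OrthantStrictlyMonotonic f) (hmonoDual : OrthantStrictlyMonotonic (dualNorm f))
    (hz : z ∈ decompositions f (f x) x) {j : Fin d} (hj : j.succ < l0 x) :
    supportDualNorm f (j + 1) (z j) = 0 := by
  by_contra hne
  refine (hxy.topDualNorm_lt_one hf hmono hmonoDual hj).ne (mul_right_cancel₀ hne ?_)
  rw [one_mul]
  exact hxy.topDualNorm_mul_eq hf hmonoDual hz j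

lemma mul_le_objective (hxy : IsDualVector f x y) (hf : IsCoerciveGauge f)
    (hmono : OrthantStrictlyMonotonic f) (hmonoDual : OrthantStrictlyMonotonic (dualNorm f))
    (hφ : Monotone φ) (hz : z ∈ decompositions f (f x) x) :
    φ (l0 x) * f x ≤ objective f φ z := by
  rw [← hxy.totalNorm_eq hf hmonoDual hz, totalNorm, Finset.mul_sum]
  refine Finset.sum_le_sum fun j _ => ?_
  rcases lt_or_ge j.succ (l0 x) with hj | hj
  · simp [hxy.supportDualNorm_eq_zero hf hmono hmonoDual hz hj]
  · exact mul_le_mul_of_nonneg_right (hφ hj) (hf.supportDualNorm_nonneg j.1.succ_pos (z j))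

lemma exists_objective_eq (hxy : IsDualVector f x y) (hf : IsCoerciveGauge f)
    (hmonoDual : OrthantStrictlyMonotonic (dualNorm f)) (hx : x ≠ 0) (φ : Fin (d + 1) → ℝ) :
    ∃ z ∈ decompositions f (f x) x, objective f φ z = φ (l0 x) * f x := by
  obtain ⟨j, hj⟩ := Fin.exists_succ_eq.mpr (l0_ne_zero hx)
  have hmem := hf.single_mem_decompositions hj
  have hnorm : supportDualNorm f (j + 1) x = f x := by
    simpa [totalNorm_eq_objective_one, hf.objective_single] using
      hxy.totalNorm_eq hf hmonoDual hmem
  exact ⟨Pi.single j x, hmem, by rw [hf.objective_single, hj, hnorm]⟩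

end IsDualVector

end Decompositions

lemma isLeast_setOf_eq_iff {α : Type*} {D : Set α} {g : α → ℝ} {r : ℝ} :
    IsLeast {t | ∃ z ∈ D, t = g z} r ↔ IsLeast (g '' D) r := by
  simp only [Set.image, eq_comm]

lemma exists_isMinValue_of_finite {S : Set ℝ} (hS : S.Finite) : ∃ m, IsMinValue S m := by
  rcases S.eq_empty_or_nonempty with hempty | hne
  · exact ⟨⊤, .inl ⟨hempty, rfl⟩⟩
  · obtain ⟨r, hr⟩ := hS.isCompact.exists_isLeast hne
    exact ⟨r, .inr ⟨r, hr, rfl⟩⟩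

lemma IsMinValue.setOf_exists_of_isLeast {α : Type*} {C : Set α} {a : α → ℝ} {m : EReal}
    {P : α → ℝ → Prop} (hm : IsMinValue (a '' C) m) (hP : ∀ x ∈ C, IsLeast {t | P x t} (a x)) :
    IsMinValue {t | ∃ x ∈ C, P x t} m := by
  rcases hm with ⟨hempty, rfl⟩ | ⟨_, ⟨⟨x₀, hx₀, rfl⟩, hmin⟩, rfl⟩
  · exact .inl ⟨by simp [Set.image_eq_empty.mp hempty], rfl⟩
  · refine .inr ⟨a x₀, ⟨⟨x₀, hx₀, (hP x₀ hx₀).1⟩, ?_⟩, rfl⟩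
    rintro t ⟨x, hx, hxt⟩
    exact (hmin ⟨x, hx, rfl⟩).trans ((hP x hx).2 hxt)

section Minima

variable {N : Seminorm ℝ (Fin d → ℝ)} {φ : Fin (d + 1) → ℝ}

lemma IsNorm.isLeast_objective (hN : IsNorm N) (hmono : OrthantStrictlyMonotonic N)
    (hmonoDual : OrthantStrictlyMonotonic (dualNorm N)) (hφ : Monotone φ) (hx : x ≠ 0) :
    IsLeast (objective N φ '' decompositions N (N x) x) (φ (l0 x) * N x) := by
  obtain ⟨y, hxy⟩ := hN.exists_isDualVector x
  refine ⟨hxy.exists_objective_eq hN.isCoerciveGauge hmonoDual hx φ, ?_⟩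
  rintro _ ⟨z, hz, rfl⟩
  exact hxy.mul_le_objective hN.isCoerciveGauge hmono hmonoDual hφ hz

lemma IsNorm.isLeast_objective_normalized (hN : IsNorm N) (hmono : OrthantStrictlyMonotonic N)
    (hmonoDual : OrthantStrictlyMonotonic (dualNorm N)) (hφ : Monotone φ) (hx : x ≠ 0) :
    IsLeast (objective N φ '' decompositions N 1 ((N x)⁻¹ • x)) (φ (l0 x)) := by
  have hNx := hN.pos hx
  have hunit : N ((N x)⁻¹ • x) = 1 := by
    rw [map_smul_eq_mul, norm_inv, Real.norm_of_nonneg hNx.le, inv_mul_cancel₀ hNx.ne']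
  have h := hN.isLeast_objective hmono hmonoDual hφ (smul_ne_zero (inv_ne_zero hNx.ne') hx)
  rwa [hunit, mul_one, l0_smul (inv_ne_zero hNx.ne')] at h

lemma IsNorm.one_div_mul_mul_self (hN : IsNorm N) (hx : x ≠ 0) (r : ℝ) :
    1 / N x * (r * N x) = r := by
  have := (hN.pos hx).ne'
  field_simp

lemma IsNorm.isLeast_one_div_mul_objective (hN : IsNorm N) (hmono : OrthantStrictlyMonotonic N)
    (hmonoDual : OrthantStrictlyMonotonic (dualNorm N)) (hφ : Monotone φ) (hx : x ≠ 0) :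
    IsLeast ((fun z => 1 / N x * objective N φ z) '' decompositions N (N x) x) (φ (l0 x)) := by
  have hscale : Monotone fun v => 1 / N x * v :=
    monotone_mul_left_of_nonneg (one_div_nonneg.mpr (apply_nonneg N x))
  have h := hscale.map_isLeast (hN.isLeast_objective hmono hmonoDual hφ hx)
  rwa [Set.image_image, hN.one_div_mul_mul_self hx] at h

lemma IsNorm.isLeast_one_div_mul_isLeast_objective (hN : IsNorm N)
    (hmono : OrthantStrictlyMonotonic N) (hmonoDual : OrthantStrictlyMonotonic (dualNorm N))
    (hφ : Monotone φ) (hx : x ≠ 0) :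
    IsLeast {t | ∃ v, IsLeast (objective N φ '' decompositions N (N x) x) v ∧ t = 1 / N x * v}
      (φ (l0 x)) := by
  have hleast := hN.isLeast_objective hmono hmonoDual hφ hx
  refine ⟨⟨_, hleast, (hN.one_div_mul_mul_self hx _).symm⟩, ?_⟩
  rintro _ ⟨v, hv, rfl⟩
  rw [hv.unique hleast, hN.one_div_mul_mul_self hx]

end Minima

end SparseReformulation

theorem mainTheorem5 {d : ℕ} (C : Set (Fin d → ℝ)) (hC : (0 : Fin d → ℝ) ∉ C)
    (N : Seminorm ℝ (Fin d → ℝ)) (hN : SparseReformulation.IsNorm N)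
    (hmono : SparseReformulation.OrthantStrictlyMonotonic N)
    (hmonoDual : SparseReformulation.OrthantStrictlyMonotonic (SparseReformulation.dualNorm N))
    (φ : Fin (d + 1) → ℝ) (hφ_nonneg : ∀ k, 0 ≤ φ k) (hφ_mono : Monotone φ) (hφ_zero : φ 0 = 0) :
    -- the four minima exist (`+∞` if `C` is empty) and are equal
    (∃ m : EReal,
      SparseReformulation.IsMinValue {t | ∃ x ∈ C, t = φ (SparseReformulation.l0 x)} m ∧
      SparseReformulation.IsMinValue
        {t | ∃ x ∈ C, ∃ z ∈ SparseReformulation.decompositions N 1 ((N x)⁻¹ • x),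
          t = SparseReformulation.objective N φ z} m ∧
      SparseReformulation.IsMinValue
        {t | ∃ x ∈ C, ∃ z ∈ SparseReformulation.decompositions N (N x) x,
          t = 1 / N x * SparseReformulation.objective N φ z} m ∧
      SparseReformulation.IsMinValue
        {t | ∃ x ∈ C, ∃ v : ℝ,
          IsLeast (SparseReformulation.objective N φ ''
            SparseReformulation.decompositions N (N x) x) v ∧ t = 1 / N x * v} m) ∧
    -- for every `x ∈ C` the inner problem attains its minimum and is a convex problem
    ∀ x ∈ C,
      (∃ v : ℝ, IsLeast (SparseReformulation.objective N φ ''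
        SparseReformulation.decompositions N (N x) x) v) ∧
      Convex ℝ (SparseReformulation.decompositions N (N x) x) ∧
      ConvexOn ℝ Set.univ (SparseReformulation.objective N φ) := by
  have hne : ∀ x ∈ C, x ≠ 0 := fun x hx => ne_of_mem_of_not_mem hx hC
  obtain ⟨m, hm⟩ := SparseReformulation.exists_isMinValue_of_finite
    ((Set.finite_range φ).subset (Set.image_subset_range φ (SparseReformulation.l0 '' C)))
  rw [Set.image_image] at hm
  refine ⟨⟨m, ?_, ?_, ?_, ?_⟩, fun x hx => ⟨?_, ?_, ?_⟩⟩
  · exact hm.setOf_exists_of_isLeast fun x _ => isLeast_singleton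
  · exact hm.setOf_exists_of_isLeast fun x hx => SparseReformulation.isLeast_setOf_eq_iff.mpr <|
      hN.isLeast_objective_normalized hmono hmonoDual hφ_mono (hne x hx)
  · exact hm.setOf_exists_of_isLeast fun x hx => SparseReformulation.isLeast_setOf_eq_iff.mpr <|
      hN.isLeast_one_div_mul_objective hmono hmonoDual hφ_mono (hne x hx)
  · exact hm.setOf_exists_of_isLeast fun x hx =>
      hN.isLeast_one_div_mul_isLeast_objective hmono hmonoDual hφ_mono (hne x hx)
  · exact ⟨_, hN.isLeast_objective hmono hmonoDual hφ_mono (hne x hx)⟩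
  · exact hN.isCoerciveGauge.convex_decompositions (N x) x
  · exact hN.isCoerciveGauge.convexOn_objective hφ_nonneg
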